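/- Let $\chi:\mathbb R\to\mathbb R$ be a kernel, that is: $(\chi_1)$ $\chi\in L^1(\mathbb R)$ is continuous on $\mathbb R$ and $\sum_{k\in\mathbb Z}\chi(u-k)=1$ for every $u\in\mathbb R$; $(\chi_2)$ $\sup_{u\in\mathbb R}\sum_{k\in\mathbb Z}|\chi(u-k)|<+\infty$, and the series $\sum_{k\in\mathbb Z}|\chi(u-k)|$ converges uniformly on the compact subsets of $\mathbb R$. For an integer $m\ge 1$ let $\bar\chi_m(t):=\frac1m\int_{-m/2}^{m/2}\chi(t+v)\,dv$ for $t\in\mathbb R$, and for $f:\mathbb R\to\mathbb R$ and $w>0$ let $$(\bar S^m_w f)(t):=\sum_{k\in\mathbb Z} f\Big(\frac kw\Big)\,\bar\chi_m(wt-k),\qquad t\in\mathbb R,$$ whenever the series converges for every $t$. Let $V[g]$ denote the Jordan (total) variation of $g:\mathbb R\to\mathbb R$ over $\mathbb R$, let $BV(\mathbb R)$ be the set of all $g:\mathbb R\to\mathbb R$ with $V[g]<+\infty$, and let $AC(\mathbb R)$ be the set of all $g\in BV(\mathbb R)$ that are absolutely continuous on every interval $[a,b]\subset\mathbb R$. **Theorem.**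 Let $\chi$ be a kernel, let $m\ge 1$ be an integer, and let $f\in BV(\mathbb R)$ (so that the series defining $\bar S^m_w f$ converges absolutely at every point). Then $$\lim_{w\to+\infty}V[\bar S^m_w f-f]=0\quad\Longleftrightarrow\quad f\in AC(\mathbb R).$$ -/

import Mathlib

open Set Filter Topology MeasureTheory

noncomputable section

namespace SamplingBV

/-- The assumptions on a kernel: `χ` is continuous and in `L¹(ℝ)`, its integer translates sum to
`1` at every point, the series `∑ |χ (u - k)|` converges uniformly on compact sets, and its sum is
bounded on `ℝ`. -/
structure IsKernel (χ : ℝ → ℝ) : Prop where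
  continuous : Continuous χ
  integrable : Integrable χ
  hasSum_one : ∀ u : ℝ, HasSum (fun k : ℤ => χ (u - k)) 1
  bddAbove_moment : BddAbove (range fun u : ℝ => ∑' k : ℤ, |χ (u - k)|)
  uniform_on_compact : ∀ K : Set ℝ, IsCompact K →
    TendstoUniformlyOn (fun (s : Finset ℤ) (u : ℝ) => ∑ k ∈ s, |χ (u - k)|)
      (fun u => ∑' k : ℤ, |χ (u - k)|) atTop K

/-- The averaged kernel `χ̄_m (t) = (1/m) ∫_{-m/2}^{m/2} χ (t + v) dv`. -/
def averagedKernel (χ : ℝ → ℝ) (m : ℕ) (t : ℝ) : ℝ :=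
  (1 / (m : ℝ)) * ∫ v in (-((m : ℝ) / 2))..((m : ℝ) / 2), χ (t + v)

/-- The generalized sampling series `(S_w f)(t) = ∑_{k ∈ ℤ} f (k / w) φ (w t - k)` with kernel
`φ`. -/
def samplingSeries (φ : ℝ → ℝ) (w : ℝ) (f : ℝ → ℝ) (t : ℝ) : ℝ :=
  ∑' k : ℤ, f (k / w) * φ (w * t - k)

/-- The Jordan variation of `f` over `ℝ`. -/
def variation (f : ℝ → ℝ) : ENNReal :=
  eVariationOn f univ

/-- The space `BV(ℝ)`. -/
def BV : Set (ℝ → ℝ) :=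
  {f | variation f < ⊤}

/-- The space `AC(ℝ)` of the functions in `BV(ℝ)` that are absolutely continuous on every compact
interval. -/
def AC : Set (ℝ → ℝ) :=
  {f | f ∈ BV ∧ ∀ a b : ℝ, AbsolutelyContinuousOnInterval f a b}

theorem IsKernel.summable_abs {χ : ℝ → ℝ} (hχ : IsKernel χ) (u : ℝ) :
    Summable (fun k : ℤ => |χ (u - k)|) :=
  ⟨_, (hχ.uniform_on_compact {u} isCompact_singleton).tendsto_at (mem_singleton u)⟩

/-- The series defining the sampling operator with an averaged kernel converges absolutely for
every `f` in `BV(ℝ)`. -/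
theorem summable_samplingSeries {χ : ℝ → ℝ} (hχ : IsKernel χ) (m : ℕ) {f : ℝ → ℝ} (hf : f ∈ BV)
    (w t : ℝ) : Summable (fun k : ℤ => |f (k / w) * averagedKernel χ m (w * t - k)|) := by
  obtain ⟨A, hA⟩ := hχ.bddAbove_moment
  have hA' : ∀ (s : Finset ℤ) (u : ℝ), ∑ k ∈ s, |χ (u - k)| ≤ A := fun s u =>
    ((hχ.summable_abs u).sum_le_tsum s (fun _ _ => abs_nonneg _)).trans (hA ⟨u, rfl⟩)
  have hab : -((m : ℝ) / 2) ≤ (m : ℝ) / 2 := by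
    have : (0 : ℝ) ≤ m := Nat.cast_nonneg m
    linarith
  have hc := hχ.continuous
  have hav : Summable (fun k : ℤ => |averagedKernel χ m (w * t - k)|) := by
    refine summable_of_sum_le
      (c := (1 / (m : ℝ)) * ∫ v in (-((m : ℝ) / 2))..((m : ℝ) / 2), A)
      (fun _ => abs_nonneg _) (fun s => ?_)
    calc ∑ k ∈ s, |averagedKernel χ m (w * t - k)|
        ≤ ∑ k ∈ s, (1 / (m : ℝ)) *
            ∫ v in (-((m : ℝ) / 2))..((m : ℝ) / 2), |χ (w * t + v - k)| := by
          refine Finset.sum_le_sum (fun k _ => ?_)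
          rw [averagedKernel, abs_mul, abs_of_nonneg (by positivity : (0 : ℝ) ≤ 1 / (m : ℝ))]
          refine mul_le_mul_of_nonneg_left ?_ (by positivity)
          refine (intervalIntegral.abs_integral_le_integral_abs hab).trans (le_of_eq ?_)
          congr 1
          ext v
          congr 2
          ring
      _ = (1 / (m : ℝ)) *
            ∫ v in (-((m : ℝ) / 2))..((m : ℝ) / 2), ∑ k ∈ s, |χ (w * t + v - k)| := by
          rw [← Finset.mul_sum, intervalIntegral.integral_finsetSum]
          intro k _
          exact Continuous.intervalIntegrable (by fun_prop) _ _
      _ ≤ _ := by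
          refine mul_le_mul_of_nonneg_left ?_ (by positivity)
          refine intervalIntegral.integral_mono_on hab
            (Continuous.intervalIntegrable (by fun_prop) _ _)
            (Continuous.intervalIntegrable (by fun_prop) _ _) (fun v _ => hA' s _)
  have hb : ∀ x, |f x| ≤ |f 0| + (variation f).toReal := by
    intro x
    have h1 : edist (f x) (f 0) ≤ variation f := eVariationOn.edist_le f (mem_univ x) (mem_univ 0)
    have h2 := ENNReal.toReal_mono (ne_of_lt hf) h1
    rw [edist_dist, ENNReal.toReal_ofReal dist_nonneg, Real.dist_eq] at h2
    have h3 := abs_sub_abs_le_abs_sub (f x) (f 0)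
    linarith
  refine Summable.of_nonneg_of_le (fun _ => abs_nonneg _) (fun k => ?_)
    (hav.mul_left (|f 0| + (variation f).toReal))
  rw [abs_mul]
  exact mul_le_mul_of_nonneg_right (hb _) (abs_nonneg _)

end SamplingBV

end

namespace SamplingBV

/-! An increment of the averaged kernel is a difference of two integrals of `χ` whose windows differ
by the integer `m`. Summation by parts therefore turns the increments of the series into integrals
of `∑ D_k χ(wy + m/2 - k)`, where `D_k` is the difference quotient of `h` over `[(k-m)/w, k/w]`
(`hasSum_samplingSeries_sub`). Writing `g` with the partition of unity given by `χ` bounds the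
variation of `S_w h - ∫ g` by an integral of `|D_k - g|` against `|χ|`
(`variation_samplingSeries_sub_primitive_le`).

With `g = 0` this yields `V[S_w h] ≤ ‖χ‖₁ V[h]`. With `h` a primitive of `g ∈ C_c`, dominated
convergence sends the bound to zero. Such primitives are dense in `AC` for the variation seminorm,
since `f' ∈ L¹`, so convergence extends to all of `AC`.

Conversely, each `S_w f` is Lipschitz, and absolute continuity on an interval survives limits in
variation. -/

/-! ### Variation: upper bounds and sums over meshes -/

theorem variation_le_measure {G : ℝ → ℝ} (μ : Measure ℝ)
    (h : ∀ s t, s ≤ t → edist (G s) (G t) ≤ μ (Ioc s t)) : variation G ≤ μ univ := by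
  refine iSup_le fun p => ?_
  obtain ⟨n, u, hu, -⟩ := p
  calc ∑ i ∈ Finset.range n, edist (G (u (i + 1))) (G (u i))
      ≤ ∑ i ∈ Finset.range n, μ (Ioc (u i) (u (i + 1))) := by
        refine Finset.sum_le_sum fun i _ => ?_
        rw [edist_comm]
        exact h _ _ (hu (Nat.le_succ i))
    _ = μ (⋃ i ∈ Finset.range n, Ioc (u i) (u (i + 1))) := by
        rw [measure_biUnion_finset]
        · intro i _ j _ hij
          exact hu.pairwise_disjoint_on_Ioc_succ hij
        · exact fun _ _ => measurableSet_Ioc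
    _ ≤ μ univ := measure_mono (subset_univ _)

theorem variation_add_le (f g : ℝ → ℝ) :
    variation (fun t => f t + g t) ≤ variation f + variation g := by
  refine iSup_le fun p => ?_
  obtain ⟨n, u, hu, hus⟩ := p
  calc ∑ i ∈ Finset.range n, edist (f (u (i + 1)) + g (u (i + 1))) (f (u i) + g (u i))
      ≤ ∑ i ∈ Finset.range n, (edist (f (u (i + 1))) (f (u i)) + edist (g (u (i + 1))) (g (u i))) :=
        Finset.sum_le_sum fun i _ => edist_add_add_le _ _ _ _
    _ ≤ _ := by
        rw [Finset.sum_add_distrib]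
        exact add_le_add (eVariationOn.sum_le hu hus) (eVariationOn.sum_le hu hus)

theorem variation_neg (f : ℝ → ℝ) : variation (fun t => -f t) = variation f := by
  simp only [variation, eVariationOn, edist_neg_neg]

theorem tsum_edist_le_variation (h : ℝ → ℝ) {w : ℝ} (hw : 0 < w) :
    ∑' k : ℤ, edist (h (k / w)) (h ((k - 1) / w)) ≤ variation h := by
  rw [ENNReal.tsum_eq_iSup_sum]
  refine iSup_le fun s => ?_
  set N : ℕ := s.sup Int.natAbs
  -- Enclose `s` in the window `[-N, N]`, so that its terms are consecutive increments along one
  -- monotone sequence.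
  have hs : s ⊆ (Finset.range (2 * N + 1)).image (fun i : ℕ => (i : ℤ) - N) := fun k hk => by
    have hkN : k.natAbs ≤ N := Finset.le_sup (f := Int.natAbs) hk
    exact Finset.mem_image.2 ⟨(k + N).toNat, Finset.mem_range.2 (by omega), by omega⟩
  refine (Finset.sum_le_sum_of_subset hs).trans ?_
  rw [Finset.sum_image fun a _ b _ hab => by simpa using hab]
  have hu : Monotone fun i : ℕ => ((i : ℝ) - N - 1) / w := fun i j hij => by
    have : (i : ℝ) ≤ j := by exact_mod_cast hij
    dsimp only
    gcongr
  refine le_trans (le_of_eq (Finset.sum_congr rfl fun i _ => ?_))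
    (eVariationOn.sum_le (f := h) (n := 2 * N + 1) hu fun _ => mem_univ _)
  push_cast
  congr 3
  ring

/-- A jump of `m` mesh steps splits into `m` unit steps, and by translating the index each of them
contributes at most one full variation. -/
theorem tsum_edist_sub_nat_le (h : ℝ → ℝ) {w : ℝ} (hw : 0 < w) (m : ℕ) :
    ∑' k : ℤ, edist (h (k / w)) (h ((k - m) / w)) ≤ m * variation h := by
  induction m with
  | zero => simp
  | succ m ih =>
    calc ∑' k : ℤ, edist (h (k / w)) (h ((k - (m + 1 : ℕ)) / w))
        ≤ ∑' k : ℤ, (edist (h (k / w)) (h ((k - m) / w)) +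
            edist (h ((k - m) / w)) (h ((k - (m + 1 : ℕ)) / w))) :=
          ENNReal.tsum_le_tsum fun k => edist_triangle _ _ _
      _ = ∑' k : ℤ, edist (h (k / w)) (h ((k - m) / w)) +
            ∑' k : ℤ, edist (h (k / w)) (h ((k - 1) / w)) := by
          rw [ENNReal.tsum_add, ← (Equiv.subRight (m : ℤ)).tsum_eq
            (fun k : ℤ => edist (h (k / w)) (h ((k - 1) / w)))]
          congr 2
          ext k
          simp only [Equiv.subRight_apply]
          push_cast
          congr 3
          ring
      _ ≤ m * variation h + variation h := add_le_add ih (tsum_edist_le_variation h hw)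
      _ = _ := by push_cast; ring

theorem lintegral_comp_mul_add (F : ℝ → ENNReal) (hF : Measurable F) {w : ℝ} (hw : 0 < w) (d : ℝ) :
    ∫⁻ y, F (w * y + d) = ENNReal.ofReal w⁻¹ * ∫⁻ x, F x := by
  have h1 : ∫⁻ y, F (w * y + d) = ∫⁻ x, F (x + d) ∂(Measure.map (w * ·) volume) := by
    rw [lintegral_map (by fun_prop) (by fun_prop)]
  rw [h1, Real.map_volume_mul_left hw.ne', lintegral_smul_measure, abs_of_pos (inv_pos.2 hw),
    lintegral_add_right_eq_self F d, smul_eq_mul]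

theorem exists_bound_of_mem_BV {f : ℝ → ℝ} (hf : f ∈ BV) : ∃ C, ∀ x, |f x| ≤ C := by
  refine ⟨|f 0| + (variation f).toReal, fun x => ?_⟩
  have h2 := ENNReal.toReal_mono (ne_of_lt hf) (eVariationOn.edist_le f (mem_univ x) (mem_univ 0))
  rw [edist_dist, ENNReal.toReal_ofReal dist_nonneg, Real.dist_eq] at h2
  linarith [abs_sub_abs_le_abs_sub (f x) (f 0)]

/-! ### Integrable derivatives and approximation by smooth primitives -/

theorem norm_deriv_le_deriv_variationOnFromTo {f : ℝ → ℝ} (hf : LocallyBoundedVariationOn f univ)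
    {x : ℝ} (hx : DifferentiableAt ℝ f x)
    (hp : DifferentiableAt ℝ (variationOnFromTo f univ 0) x) :
    ‖deriv f x‖ ≤ deriv (variationOnFromTo f univ 0) x := by
  set p := variationOnFromTo f univ 0
  have key : ∀ a b, a ≤ b → |f b - f a| ≤ p b - p a := by
    intro a b hab
    have h1 : p b - p a = variationOnFromTo f univ a b := by
      have := variationOnFromTo.add hf (mem_univ 0) (mem_univ a) (mem_univ b)
      simp only [p]; linarith
    rw [h1, variationOnFromTo.eq_of_le f univ hab, ← Real.dist_eq, dist_edist]
    refine ENNReal.toReal_mono (hf a b (mem_univ _) (mem_univ _)) ?_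
    exact eVariationOn.edist_le f ⟨mem_univ _, right_mem_Icc.2 hab⟩ ⟨mem_univ _, left_mem_Icc.2 hab⟩
  have h1 : Monotone (fun y => p y - f y) := fun a b hab => by
    have := abs_le.1 (key a b hab); dsimp only; linarith
  have h2 : Monotone (fun y => p y + f y) := fun a b hab => by
    have := abs_le.1 (key a b hab); dsimp only; linarith
  have h3 := h1.deriv_nonneg (x := x)
  have h4 := h2.deriv_nonneg (x := x)
  rw [deriv_fun_sub hp hx] at h3
  rw [deriv_fun_add hp hx] at h4
  rw [Real.norm_eq_abs, abs_le]
  constructor <;> linarith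

/-- Almost everywhere `|f'| ≤ p'` with `p` the variation function, and the integral of `p'` is at
most the increment of the monotone `p`, hence at most `V[f]`. -/
theorem integrable_deriv_of_mem_AC {f : ℝ → ℝ} (hf : f ∈ AC) : Integrable (deriv f) := by
  obtain ⟨hV, hac⟩ := hf
  have hlb : LocallyBoundedVariationOn f univ :=
    BoundedVariationOn.locallyBoundedVariationOn (ne_of_lt hV)
  set p := variationOnFromTo f univ 0
  have hp : Monotone p := fun a b hab =>
    variationOnFromTo.monotoneOn hlb (mem_univ 0) (mem_univ a) (mem_univ b) hab
  have hfd : ∀ᵐ x, DifferentiableAt ℝ f x := hlb.ae_differentiableAt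
  have hle : ∀ᵐ x, ‖deriv f x‖ ≤ deriv p x := by
    filter_upwards [hfd, hp.ae_differentiableAt] with x h1 h2
    exact norm_deriv_le_deriv_variationOnFromTo hlb h1 h2
  refine integrable_of_intervalIntegral_norm_bounded (l := (atTop : Filter ℝ)) (a := fun i => -i)
    (b := fun i => i) (variation f).toReal (fun i => ?_) tendsto_neg_atTop_atBot tendsto_id ?_
  · exact (hac (-i) i).intervalIntegrable_deriv.1
  · filter_upwards [eventually_ge_atTop 0] with i hi
    have hi' : -i ≤ i := by linarith
    have hpm : MonotoneOn p (uIcc (-i) i) := hp.monotoneOn _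
    calc ∫ x in -i..i, ‖deriv f x‖ ≤ ∫ x in -i..i, deriv p x :=
          intervalIntegral.integral_mono_ae hi' (hac (-i) i).intervalIntegrable_deriv.norm
            hpm.intervalIntegrable_deriv hle
      _ ≤ p i - p (-i) := by
          have := hpm.intervalIntegral_deriv_mem_uIcc
          rw [uIcc_of_le (sub_nonneg.2 (hp hi'))] at this
          exact this.2
      _ = variationOnFromTo f univ (-i) i := by
          have := variationOnFromTo.add hlb (mem_univ 0) (mem_univ (-i)) (mem_univ i)
          simp only [p]; linarith
      _ ≤ _ := by
          rw [variationOnFromTo.eq_of_le f univ hi']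
          exact ENNReal.toReal_mono (ne_of_lt hV) (eVariationOn.mono f inter_subset_left)

theorem enorm_intervalIntegral_le {φ : ℝ → ℝ} {s t : ℝ} (hst : s ≤ t) :
    ‖∫ y in s..t, φ y‖ₑ ≤ ∫⁻ y in Ioc s t, ‖φ y‖ₑ := by
  rw [intervalIntegral.integral_of_le hst]
  exact enorm_integral_le_lintegral_enorm _

theorem variation_le_lintegral {G φ : ℝ → ℝ}
    (h : ∀ s t, s ≤ t → G t - G s = ∫ y in s..t, φ y) : variation G ≤ ∫⁻ y, ‖φ y‖ₑ := by
  have := variation_le_measure (G := G) (volume.withDensity fun y => ‖φ y‖ₑ) fun s t hst => by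
    rw [withDensity_apply _ measurableSet_Ioc, edist_comm, edist_eq_enorm_sub, h s t hst]
    exact enorm_intervalIntegral_le hst
  rwa [withDensity_apply _ MeasurableSet.univ, Measure.restrict_univ] at this

theorem exists_variation_sub_primitive_le {f : ℝ → ℝ} (hf : f ∈ AC) {ε : ℝ} (hε : 0 < ε) :
    ∃ g : ℝ → ℝ, Continuous g ∧ HasCompactSupport g ∧
      variation (fun t => f t - ∫ y in 0..t, g y) ≤ ENNReal.ofReal ε := by
  have hint := integrable_deriv_of_mem_AC hf
  obtain ⟨g, hgs, hle, hgc, hgi⟩ := hint.exists_hasCompactSupport_integral_sub_le hε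
  refine ⟨g, hgc, hgs, (variation_le_lintegral (φ := fun y => deriv f y - g y) ?_).trans ?_⟩
  · intro s t _
    rw [intervalIntegral.integral_sub hint.intervalIntegrable hgi.intervalIntegrable,
      (hf.2 s t).integral_deriv_eq_sub, ← intervalIntegral.integral_interval_sub_left
        (hgi.intervalIntegrable (a := 0) (b := t)) (hgi.intervalIntegrable (a := 0) (b := s))]
    ring
  · refine (ofReal_integral_norm_eq_lintegral_enorm (hint.sub hgi)).symm.trans_le ?_
    exact ENNReal.ofReal_le_ofReal hle

/-! ### Increments of the sampling series as integrals -/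

theorem IsKernel.exists_moment_bound {χ : ℝ → ℝ} (hχ : IsKernel χ) :
    ∃ A, ∀ (F : Finset ℤ) (u : ℝ), ∑ k ∈ F, |χ (u - k)| ≤ A := by
  obtain ⟨A, hA⟩ := hχ.bddAbove_moment
  exact ⟨A, fun F u =>
    ((hχ.summable_abs u).sum_le_tsum F fun _ _ => abs_nonneg _).trans (hA ⟨u, rfl⟩)⟩

theorem sum_integral_abs_comp_le {χ : ℝ → ℝ} (hc : Continuous χ) {A : ℝ}
    (hA : ∀ (F : Finset ℤ) (u : ℝ), ∑ k ∈ F, |χ (u - k)| ≤ A) (w d : ℝ) {s t : ℝ} (hst : s ≤ t)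
    (F : Finset ℤ) : ∑ k ∈ F, ∫ y in s..t, |χ (w * y + d - k)| ≤ A * (t - s) := by
  rw [← intervalIntegral.integral_finsetSum fun k _ =>
    Continuous.intervalIntegrable (by fun_prop) _ _]
  refine (intervalIntegral.integral_mono_on (g := fun _ => A) hst
    (Continuous.intervalIntegrable (by fun_prop) _ _)
    (Continuous.intervalIntegrable (by fun_prop) _ _) fun y _ => hA F _).trans_eq ?_
  rw [intervalIntegral.integral_const, smul_eq_mul, mul_comm]

theorem summable_integral_abs_comp {χ : ℝ → ℝ} (hχ : IsKernel χ) (w d : ℝ) {s t : ℝ}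
    (hst : s ≤ t) : Summable fun k : ℤ => ∫ y in s..t, |χ (w * y + d - k)| := by
  obtain ⟨A, hA⟩ := hχ.exists_moment_bound
  exact summable_of_sum_le
    (fun k => intervalIntegral.integral_nonneg hst fun _ _ => abs_nonneg _)
    (sum_integral_abs_comp_le hχ.continuous hA w d hst)

theorem averagedKernel_eq (χ : ℝ → ℝ) (m : ℕ) (t : ℝ) :
    averagedKernel χ m t = (1 / (m : ℝ)) * ∫ x in (t - m / 2)..(t + m / 2), χ x := by
  rw [averagedKernel, intervalIntegral.integral_comp_add_left (fun x => χ x), sub_eq_add_neg]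

/-- Regroup the four endpoints into a right and a left window. Because `m` is an integer, the left
window is the right one for the index `k + m`. -/
theorem averagedKernel_sub {χ : ℝ → ℝ} (hc : Continuous χ) (m : ℕ) (w s t : ℝ) (k : ℤ) :
    averagedKernel χ m (w * t - k) - averagedKernel χ m (w * s - k) =
      w / m * ((∫ y in s..t, χ (w * y + m / 2 - k)) -
        ∫ y in s..t, χ (w * y + m / 2 - (k + m : ℤ))) := by
  have hi : ∀ a b, IntervalIntegrable χ volume a b := fun a b => hc.intervalIntegrable a b
  have hsub : ∀ j : ℤ, w * ∫ y in s..t, χ (w * y + m / 2 - j) =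
      ∫ x in (w * s + (m / 2 - j))..(w * t + (m / 2 - j)), χ x := fun j => by
    rw [← intervalIntegral.mul_integral_comp_mul_add]
    simp only [add_sub_assoc]
  rw [averagedKernel_eq, averagedKernel_eq, ← mul_sub,
    intervalIntegral.integral_interval_sub_interval_comm' (hi _ _) (hi _ _) (hi _ _),
    show ∀ a b : ℝ, w / m * (a - b) = 1 / m * (w * a - w * b) by intros; ring, hsub, hsub]
  congr 2
  · congr 1 <;> ring
  · congr 1 <;> (push_cast; ring)

theorem hasSum_samplingSeries_sub {χ : ℝ → ℝ} (hχ : IsKernel χ) (m : ℕ) {h : ℝ → ℝ} (hh : h ∈ BV)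
    (w : ℝ) {s t : ℝ} (hst : s ≤ t) :
    HasSum (fun k : ℤ => w / m * (h (k / w) - h ((k - m) / w)) *
        ∫ y in s..t, χ (w * y + m / 2 - k))
      (samplingSeries (averagedKernel χ m) w h t - samplingSeries (averagedKernel χ m) w h s) := by
  obtain ⟨C, hC⟩ := exists_bound_of_mem_BV hh
  have hsum : ∀ c : ℤ → ℝ, (∀ k, |c k| ≤ C) →
      Summable fun k : ℤ => c k * ∫ y in s..t, χ (w * y + m / 2 - k) := fun c hc => by
    refine Summable.of_norm_bounded ((summable_integral_abs_comp hχ w (m / 2) hst).mul_left C)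
      fun k => ?_
    rw [norm_mul]
    exact mul_le_mul (hc k) (intervalIntegral.abs_integral_le_integral_abs hst) (norm_nonneg _)
      ((abs_nonneg _).trans (hc k))
  have hA := (hsum (fun k => h (k / w)) fun k => hC _).hasSum
  have hB := (hsum (fun k => h ((k - m) / w)) fun k => hC _).hasSum
  -- Summation by parts: the index shift by `m` moves the difference from the kernel to `h`.
  have hB' := (Equiv.addRight (m : ℤ)).hasSum_iff.2 hB
  have hS := (summable_samplingSeries hχ m hh w t).of_abs.hasSum.sub
    (summable_samplingSeries hχ m hh w s).of_abs.hasSum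
  have hS' := (hA.sub hB').mul_left (w / m)
  have heq := hS.unique (hS'.congr_fun fun k => ?_)
  · rw [samplingSeries, samplingSeries, heq]
    refine ((hA.sub hB).mul_left (w / m)).congr_fun fun k => ?_
    ring
  · rw [← mul_sub, averagedKernel_sub hχ.continuous]
    simp only [Function.comp_apply, Equiv.coe_addRight]
    push_cast
    rw [add_sub_cancel_right]
    ring

theorem hasSum_integral_mul_kernel {χ : ℝ → ℝ} (hχ : IsKernel χ) {g : ℝ → ℝ} (hg : Continuous g)
    {C : ℝ} (hC : ∀ x, |g x| ≤ C) (w d : ℝ) {s t : ℝ} (hst : s ≤ t) :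
    HasSum (fun k : ℤ => ∫ y in s..t, g y * χ (w * y + d - k)) (∫ y in s..t, g y) := by
  have hc := hχ.continuous
  have hcont : ∀ k : ℤ, Continuous fun y => g y * χ (w * y + d - k) := fun k => by fun_prop
  have := hasSum_integral_of_summable_integral_norm (μ := volume.restrict (Ioc s t))
    (F := fun (k : ℤ) y => g y * χ (w * y + d - k))
    (fun k => ((hcont k).intervalIntegrable s t).1) ?_
  · simp only [tsum_mul_left, (hχ.hasSum_one _).tsum_eq, mul_one] at this
    simpa only [intervalIntegral.integral_of_le hst] using this
  · refine Summable.of_nonneg_of_le (fun k => integral_nonneg fun _ => norm_nonneg _) (fun k => ?_)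
      ((summable_integral_abs_comp hχ w d hst).mul_left C)
    rw [← intervalIntegral.integral_of_le hst, ← intervalIntegral.integral_const_mul]
    refine intervalIntegral.integral_mono_on hst ((hcont k).norm.intervalIntegrable _ _)
      (Continuous.intervalIntegrable (by fun_prop) _ _) fun y _ => ?_
    rw [norm_mul]
    exact mul_le_mul_of_nonneg_right (hC y) (abs_nonneg _)

/-! ### Comparing the series with a primitive -/

/-- The `w`-mesh discrepancy between the difference quotients of `h` and the function `g`. -/
noncomputable def meshDiscrepancy (m : ℕ) (h g : ℝ → ℝ) (w x : ℝ) : ENNReal :=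
  ENNReal.ofReal w⁻¹ *
    ∑' k : ℤ, ‖w / m * (h (k / w) - h ((k - m) / w)) - g ((x - (m / 2 - k)) / w)‖ₑ

theorem variation_samplingSeries_sub_primitive_le {χ : ℝ → ℝ} (hχ : IsKernel χ) (m : ℕ)
    {h g : ℝ → ℝ} (hh : h ∈ BV) (hg : Continuous g) {C : ℝ} (hC : ∀ x, |g x| ≤ C) {w : ℝ}
    (hw : 0 < w) :
    variation (fun t => samplingSeries (averagedKernel χ m) w h t - ∫ y in 0..t, g y) ≤
      ∫⁻ x, meshDiscrepancy m h g w x * ‖χ x‖ₑ := by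
  have hc := hχ.continuous
  set D : ℤ → ℝ := fun k => w / m * (h (k / w) - h ((k - m) / w))
  set Φ : ℤ → ℝ → ℝ := fun k y => (D k - g y) * χ (w * y + m / 2 - k)
  have hΦ : ∀ k, Continuous (Φ k) := fun k => by fun_prop
  have hgi : ∀ a b, IntervalIntegrable g volume a b := fun a b => hg.intervalIntegrable a b
  have hle := variation_le_measure
    (G := fun t => samplingSeries (averagedKernel χ m) w h t - ∫ y in 0..t, g y)
    (volume.withDensity fun y => ∑' k, ‖Φ k y‖ₑ) fun s t hst => by
      rw [withDensity_apply _ measurableSet_Ioc, edist_comm, edist_eq_enorm_sub,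
        lintegral_tsum fun k => (hΦ k).enorm.measurable.aemeasurable]
      have h1 := (hasSum_samplingSeries_sub hχ m hh w hst).sub
        (hasSum_integral_mul_kernel hχ hg hC w (m / 2) hst)
      rw [← intervalIntegral.integral_interval_sub_left (hgi 0 t) (hgi 0 s)] at h1
      have h2 : HasSum (fun k => ∫ y in s..t, Φ k y)
          (samplingSeries (averagedKernel χ m) w h t - (∫ y in 0..t, g y) -
            (samplingSeries (averagedKernel χ m) w h s - ∫ y in 0..s, g y)) := by
        rw [sub_sub_sub_comm]
        refine h1.congr_fun fun k => ?_
        simp only [Φ, sub_mul]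
        rw [intervalIntegral.integral_sub (Continuous.intervalIntegrable (by fun_prop) _ _)
          (Continuous.intervalIntegrable (by fun_prop) _ _),
          intervalIntegral.integral_const_mul]
      rw [← h2.tsum_eq]
      exact enorm_tsum_le_tsum_enorm.trans
        (ENNReal.tsum_le_tsum fun k => enorm_intervalIntegral_le hst)
  refine hle.trans (le_of_eq ?_)
  rw [withDensity_apply _ MeasurableSet.univ, Measure.restrict_univ,
    lintegral_tsum fun k => (hΦ k).enorm.measurable.aemeasurable]
  simp only [meshDiscrepancy, mul_assoc]
  rw [lintegral_const_mul' _ _ ENNReal.ofReal_ne_top]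
  simp only [← ENNReal.tsum_mul_right]
  have hmeas : ∀ k : ℤ, Measurable fun x => ‖D k - g ((x - (m / 2 - k)) / w)‖ₑ * ‖χ x‖ₑ := fun k =>
    (Continuous.enorm (by fun_prop)).measurable.mul hc.enorm.measurable
  rw [lintegral_tsum fun k => (hmeas k).aemeasurable, ← ENNReal.tsum_mul_left]
  congr 1
  ext k
  -- The substitution `x = w y + m/2 - k` makes every term carry the same weight `|χ x|`; its
  -- Jacobian is the factor `w⁻¹`.
  rw [← lintegral_comp_mul_add _ (hmeas k) hw (m / 2 - k)]
  refine lintegral_congr fun y => ?_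
  rw [add_sub_cancel_right, mul_div_cancel_left₀ _ hw.ne', ← enorm_mul, ← add_sub_assoc]

theorem meshDiscrepancy_zero_le {m : ℕ} (hm : 1 ≤ m) (h : ℝ → ℝ) {w : ℝ} (hw : 0 < w) (x : ℝ) :
    meshDiscrepancy m h 0 w x ≤ variation h := by
  have hm' : (0 : ℝ) < m := by exact_mod_cast hm
  have hE : ∀ k : ℤ, ‖w / m * (h (k / w) - h ((k - m) / w)) -
      (0 : ℝ → ℝ) ((x - (m / 2 - k)) / w)‖ₑ =
      ENNReal.ofReal (w / m) * edist (h (k / w)) (h ((k - m) / w)) := fun k => by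
    rw [Pi.zero_apply, sub_zero, enorm_mul, edist_eq_enorm_sub,
      Real.enorm_of_nonneg (by positivity)]
  rw [meshDiscrepancy]
  simp only [hE, ENNReal.tsum_mul_left]
  rw [← mul_assoc, ← ENNReal.ofReal_mul (by positivity), show w⁻¹ * (w / m) = (m : ℝ)⁻¹ by field_simp]
  calc _ ≤ ENNReal.ofReal (m : ℝ)⁻¹ * (m * variation h) := by
        gcongr
        exact tsum_edist_sub_nat_le h hw m
    _ = variation h := by
        rw [← mul_assoc, ← ENNReal.ofReal_natCast m, ← ENNReal.ofReal_mul (by positivity),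
          inv_mul_cancel₀ hm'.ne', ENNReal.ofReal_one, one_mul]

theorem variation_samplingSeries_le {χ : ℝ → ℝ} (hχ : IsKernel χ) {m : ℕ} (hm : 1 ≤ m)
    {h : ℝ → ℝ} (hh : h ∈ BV) {w : ℝ} (hw : 0 < w) :
    variation (samplingSeries (averagedKernel χ m) w h) ≤ variation h * ∫⁻ x, ‖χ x‖ₑ := by
  have h1 := variation_samplingSeries_sub_primitive_le hχ m hh (g := 0) continuous_zero (C := 0)
    (by simp) hw
  simp only [Pi.zero_apply, intervalIntegral.integral_zero, sub_zero] at h1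
  refine h1.trans ?_
  rw [← lintegral_const_mul _ hχ.continuous.enorm.measurable]
  exact lintegral_mono fun x => mul_le_mul_left (meshDiscrepancy_zero_le hm h hw x) _

/-! ### Convergence for primitives of compactly supported functions -/

/-- A closed interval of length `2r` contains at most `2r + 1` integers. -/
theorem tsum_le_of_eq_zero_of_lt {u : ℤ → ENNReal} {a r : ℝ} (hr : 0 ≤ r) {c : ENNReal}
    (hc : ∀ k, u k ≤ c) (h0 : ∀ k : ℤ, r < |k + a| → u k = 0) :
    ∑' k, u k ≤ ENNReal.ofReal (2 * r + 1) * c := by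
  have hcard : ((Finset.Icc ⌈-r - a⌉ ⌊r - a⌋).card : ℝ) ≤ 2 * r + 1 := by
    rw [Int.card_Icc, ← Int.cast_natCast (R := ℝ), Int.toNat_eq_max]
    push_cast
    refine max_le ?_ (by positivity)
    linarith [Int.floor_le (r - a), Int.le_ceil (-r - a)]
  rw [tsum_eq_sum (s := Finset.Icc ⌈-r - a⌉ ⌊r - a⌋)]
  · refine (Finset.sum_le_card_nsmul _ _ c fun k _ => hc k).trans ?_
    rw [nsmul_eq_mul, ← ENNReal.ofReal_natCast]
    gcongr
  · intro k hk
    refine h0 k (lt_of_not_ge fun hle => hk ?_)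
    rw [abs_le] at hle
    rw [Finset.mem_Icc, Int.ceil_le, Int.le_floor]
    constructor <;> linarith

theorem primitive_mem_BV {g : ℝ → ℝ} (hg : Integrable g) :
    (fun t => ∫ y in 0..t, g y) ∈ BV := by
  refine (variation_le_lintegral (φ := g) fun s t _ => ?_).trans_lt hg.2
  exact intervalIntegral.integral_interval_sub_left hg.intervalIntegrable hg.intervalIntegrable

theorem enorm_mesh_quotient_sub_le {g : ℝ → ℝ} (hg : Continuous g) {m : ℕ} (hm : 1 ≤ m) {w : ℝ}
    (hw : 0 < w) (k : ℤ) (z : ℝ) {c : ℝ}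
    (hc : ∀ y ∈ Icc ((k - m) / w) (k / w), |g y - g z| ≤ c) :
    ‖w / m * ((∫ y in 0..(k / w), g y) - ∫ y in 0..((k - m) / w), g y) - g z‖ₑ ≤
      ENNReal.ofReal c := by
  have hm' : (0 : ℝ) < m := by exact_mod_cast hm
  have hgi : ∀ a b, IntervalIntegrable g volume a b := fun a b => hg.intervalIntegrable a b
  have hle : (k - m) / w ≤ k / w := by gcongr; linarith
  have hlen : w / m * (k / w - (k - m) / w) = 1 := by field_simp; ring
  have heq : w / m * ((∫ y in 0..(k / w), g y) - ∫ y in 0..((k - m) / w), g y) - g z =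
      w / m * ∫ y in ((k - m) / w)..(k / w), (g y - g z) := by
    rw [intervalIntegral.integral_interval_sub_left (hgi _ _) (hgi _ _),
      intervalIntegral.integral_sub (hgi _ _) (by simp), intervalIntegral.integral_const,
      smul_eq_mul, mul_sub, ← mul_assoc, hlen, one_mul]
  rw [heq, ← ofReal_norm]
  refine ENNReal.ofReal_le_ofReal ?_
  rw [norm_mul, Real.norm_of_nonneg (by positivity : 0 ≤ w / m)]
  calc _ ≤ w / m * (c * |k / w - (k - m) / w|) := by
        refine mul_le_mul_of_nonneg_left ?_ (by positivity)
        refine intervalIntegral.norm_integral_le_of_norm_le_const fun y hy => hc y ?_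
        rw [uIoc_of_le hle] at hy
        exact Ioc_subset_Icc_self hy
    _ = c := by
        rw [abs_of_nonneg (sub_nonneg.2 hle), mul_left_comm, hlen, mul_one]

theorem exists_forall_lt_abs_eq_zero {g : ℝ → ℝ} (hgs : HasCompactSupport g) :
    ∃ R, 0 ≤ R ∧ ∀ y, R < |y| → g y = 0 := by
  obtain ⟨R, hR⟩ := hgs.isCompact.isBounded.subset_closedBall 0
  refine ⟨max R 0, le_max_right _ _, fun y hy => by_contra fun hne => ?_⟩
  have := hR (subset_tsupport g hne)
  rw [mem_closedBall_zero_iff, Real.norm_eq_abs] at this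
  exact absurd hy (not_lt.2 (this.trans (le_max_left _ _)))

/-- Only `O(w)` indices contribute, which the factor `w⁻¹` offsets, and each term is small by
uniform continuity: a difference quotient of the primitive is a mean of `g` at points within `(|x| +
m)/w` of the sample point. -/
theorem tendsto_meshDiscrepancy_primitive {g : ℝ → ℝ} (hg : Continuous g)
    (hgs : HasCompactSupport g) {m : ℕ} (hm : 1 ≤ m) (x : ℝ) :
    Tendsto (fun w => meshDiscrepancy m (fun t => ∫ y in 0..t, g y) g w x) atTop (𝓝 0) := by
  obtain ⟨R, hR0, hR⟩ := exists_forall_lt_abs_eq_zero hgs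
  have huc := hgs.uniformContinuous_of_continuous hg
  have hm' : (0 : ℝ) < m := by exact_mod_cast hm
  rw [ENNReal.tendsto_nhds_zero]
  intro ε hε
  obtain ⟨η, -, hη0, hηε⟩ := ENNReal.lt_iff_exists_real_btwn.1 hε
  rw [ENNReal.ofReal_pos] at hη0
  -- For `w ≥ 1` at most `w K` indices contribute, hence the tolerance `η / K` per term.
  set K := 2 * (R + |x| + m) + 1
  have hK : 0 < K := by positivity
  obtain ⟨δ, hδ, hgδ⟩ := Metric.uniformContinuous_iff.1 huc (η / K) (by positivity)
  filter_upwards [eventually_ge_atTop 1, eventually_gt_atTop ((|x| + m) / δ)] with w hw1 hwδ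
  have hw : 0 < w := by linarith
  have hwδ' : (|x| + m) / w < δ := by
    rw [div_lt_iff₀ hδ] at hwδ
    rwa [div_lt_iff₀ hw, mul_comm]
  have hx := neg_abs_le x
  have hx' := le_abs_self x
  calc meshDiscrepancy m (fun t => ∫ y in 0..t, g y) g w x
      ≤ ENNReal.ofReal w⁻¹ *
          (ENNReal.ofReal (2 * (R * w + |x| + m) + 1) * ENNReal.ofReal (η / K)) := by
        refine mul_le_mul_right (tsum_le_of_eq_zero_of_lt (a := 0) (by positivity)
          (fun k => ?_) fun k hk => ?_) _
        · refine enorm_mesh_quotient_sub_le hg hm hw k _ fun y hy => ?_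
          rw [← Real.dist_eq]
          refine (hgδ (lt_of_le_of_lt ?_ hwδ')).le
          rw [Real.dist_eq, abs_le, ← sub_nonneg, ← sub_nonneg (b := y - _)]
          rw [mem_Icc, div_le_iff₀ hw, le_div_iff₀ hw] at hy
          constructor
          · rw [show y - (x - (m / 2 - k)) / w - -((|x| + m) / w) =
              (y * w - (x - (m / 2 - k)) + (|x| + m)) / w by field_simp; ring]
            exact div_nonneg (by linarith) hw.le
          · rw [show (|x| + m) / w - (y - (x - (m / 2 - k)) / w) =
              ((|x| + m) - (y * w - (x - (m / 2 - k)))) / w by field_simp]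
            exact div_nonneg (by linarith) hw.le
        · rw [add_zero] at hk
          have hzero : ∀ v : ℝ, |v * w - k| ≤ |x| + m → g v = 0 := fun v hv => by
            refine hR v (lt_of_mul_lt_mul_right ?_ hw.le)
            rw [← abs_of_pos hw, ← abs_mul, abs_of_pos hw]
            have := abs_sub_abs_le_abs_sub (k : ℝ) (v * w)
            rw [abs_sub_comm] at this
            linarith
          have hz : g ((x - (m / 2 - k)) / w) = 0 := hzero _ <| by
            rw [div_mul_cancel₀ _ hw.ne', abs_le]
            constructor <;> linarith
          refine le_antisymm ?_ zero_le
          rw [← ENNReal.ofReal_zero]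
          refine enorm_mesh_quotient_sub_le hg hm hw k _ fun y hy => ?_
          rw [mem_Icc, div_le_iff₀ hw, le_div_iff₀ hw] at hy
          rw [hz, hzero y (by rw [abs_le]; constructor <;> linarith [abs_nonneg x]), sub_zero,
            abs_zero]
    _ ≤ ENNReal.ofReal η := by
        rw [← ENNReal.ofReal_mul (by positivity), ← ENNReal.ofReal_mul (by positivity)]
        refine ENNReal.ofReal_le_ofReal ?_
        have h1 : 2 * (R * w + |x| + m) + 1 ≤ w * K := by
          have := mul_le_mul_of_nonneg_right hw1 (by positivity : 0 ≤ 2 * (|x| + m) + 1)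
          simp only [K]
          linarith
        calc _ ≤ w⁻¹ * (w * K * (η / K)) := by gcongr
          _ = η := by field_simp
    _ ≤ ε := hηε.le

/-- Being uniform in `w ≥ 1` and in `x`, this bound times `|χ|` is the integrable majorant for
dominated convergence. -/
theorem meshDiscrepancy_primitive_le {g : ℝ → ℝ} {R C : ℝ} (hR0 : 0 ≤ R)
    (hR : ∀ y, R < |y| → g y = 0) (hC : ∀ y, |g y| ≤ C) {m : ℕ} (hm : 1 ≤ m) {w : ℝ}
    (hw : 1 ≤ w) (h : ℝ → ℝ) (x : ℝ) :
    meshDiscrepancy m h g w x ≤ variation h + ENNReal.ofReal ((2 * R + 1) * C) := by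
  have hw0 : 0 < w := by linarith
  have h1 : meshDiscrepancy m h g w x ≤ meshDiscrepancy m h 0 w x +
      ENNReal.ofReal w⁻¹ * ∑' k : ℤ, ‖g ((x - (m / 2 - k)) / w)‖ₑ := by
    rw [meshDiscrepancy, meshDiscrepancy, ← mul_add, ← ENNReal.tsum_add]
    refine mul_le_mul_right (ENNReal.tsum_le_tsum fun k => ?_) _
    rw [Pi.zero_apply, sub_zero]
    exact enorm_sub_le
  refine h1.trans (add_le_add (meshDiscrepancy_zero_le hm h hw0 x) ?_)
  calc _ ≤ ENNReal.ofReal w⁻¹ * (ENNReal.ofReal (2 * (R * w) + 1) * ENNReal.ofReal C) := by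
        refine mul_le_mul_right (tsum_le_of_eq_zero_of_lt (a := x - m / 2) (by positivity)
          (fun k => ?_) fun k hk => ?_) _
        · rw [← ofReal_norm]
          exact ENNReal.ofReal_le_ofReal (hC _)
        · rw [hR, enorm_zero]
          rwa [abs_div, abs_of_pos hw0, lt_div_iff₀ hw0, sub_sub_eq_add_sub, add_comm x,
            add_sub_assoc]
    _ ≤ _ := by
        have hC0 : 0 ≤ C := (abs_nonneg _).trans (hC 0)
        rw [← ENNReal.ofReal_mul (by positivity), ← ENNReal.ofReal_mul (by positivity)]
        refine ENNReal.ofReal_le_ofReal ?_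
        calc _ ≤ w⁻¹ * (w * (2 * R + 1) * C) := by
              gcongr
              linarith
          _ = _ := by field_simp

theorem tendsto_variation_samplingSeries_primitive {χ : ℝ → ℝ} (hχ : IsKernel χ) {m : ℕ}
    (hm : 1 ≤ m) {g : ℝ → ℝ} (hg : Continuous g) (hgs : HasCompactSupport g) :
    Tendsto (fun w => variation fun t =>
      samplingSeries (averagedKernel χ m) w (fun t => ∫ y in 0..t, g y) t - ∫ y in 0..t, g y)
      atTop (𝓝 0) := by
  obtain ⟨R, hR0, hR⟩ := exists_forall_lt_abs_eq_zero hgs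
  obtain ⟨C, hC⟩ := hgs.exists_bound_of_continuous hg
  have hBV := primitive_mem_BV (hg.integrable_of_hasCompactSupport hgs)
  have hχm : Measurable fun x => ‖χ x‖ₑ := hχ.continuous.enorm.measurable
  have hlim : Tendsto (fun w => ∫⁻ x, meshDiscrepancy m (fun t => ∫ y in 0..t, g y) g w x * ‖χ x‖ₑ)
      atTop (𝓝 (∫⁻ _ : ℝ, 0)) := by
    refine tendsto_lintegral_filter_of_dominated_convergence (fun x =>
      (variation (fun t => ∫ y in 0..t, g y) + ENNReal.ofReal ((2 * R + 1) * C)) * ‖χ x‖ₑ)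
      (Eventually.of_forall fun w => ?_) ?_ ?_ (Eventually.of_forall fun x => ?_)
    · refine Measurable.mul (Measurable.const_mul (Measurable.tsum fun k => ?_) _) hχm
      exact (Continuous.enorm (by fun_prop)).measurable
    · filter_upwards [eventually_ge_atTop 1] with w hw
      refine Eventually.of_forall fun x => mul_le_mul_left ?_ _
      exact meshDiscrepancy_primitive_le hR0 hR hC hm hw _ x
    · rw [lintegral_const_mul _ hχm]
      exact ENNReal.mul_ne_top (ENNReal.add_ne_top.2 ⟨ne_of_lt hBV, ENNReal.ofReal_ne_top⟩)
        hχ.integrable.2.ne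
    · simpa using ENNReal.Tendsto.mul_const (tendsto_meshDiscrepancy_primitive hg hgs hm x)
        (Or.inr enorm_ne_top)
  rw [lintegral_zero] at hlim
  refine tendsto_of_tendsto_of_tendsto_of_le_of_le' tendsto_const_nhds hlim
    (Eventually.of_forall fun _ => zero_le) ?_
  filter_upwards [eventually_gt_atTop 0] with w hw
  exact variation_samplingSeries_sub_primitive_le hχ m hBV hg hC hw

/-! ### Absolute continuity implies convergence -/

theorem samplingSeries_sub {χ : ℝ → ℝ} (hχ : IsKernel χ) (m : ℕ) {f h : ℝ → ℝ} (hf : f ∈ BV)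
    (hh : h ∈ BV) (w t : ℝ) :
    samplingSeries (averagedKernel χ m) w (fun t => f t - h t) t =
      samplingSeries (averagedKernel χ m) w f t - samplingSeries (averagedKernel χ m) w h t := by
  simp only [samplingSeries]
  rw [← (summable_samplingSeries hχ m hf w t).of_abs.tsum_sub
    (summable_samplingSeries hχ m hh w t).of_abs]
  simp only [sub_mul]

theorem tendsto_variation_of_mem_AC {χ : ℝ → ℝ} (hχ : IsKernel χ) {m : ℕ} (hm : 1 ≤ m)
    {f : ℝ → ℝ} (hf : f ∈ AC) :
    Tendsto (fun w => variation fun t => samplingSeries (averagedKernel χ m) w f t - f t)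
      atTop (𝓝 0) := by
  rw [ENNReal.tendsto_nhds_zero]
  intro ε hε
  obtain ⟨η, -, hη0, hηε⟩ := ENNReal.lt_iff_exists_real_btwn.1 hε
  rw [ENNReal.ofReal_pos] at hη0
  set N := ∫ x, ‖χ x‖
  have hN : 0 ≤ N := integral_nonneg fun _ => norm_nonneg _
  obtain ⟨g, hg, hgs, hV⟩ := exists_variation_sub_primitive_le hf
    -- The error `f - F` enters twice, through the operator (factor `N`) and directly (factor `1`),
    -- and so costs `η / 2` in total.
    (ε := η / (2 * (N + 1))) (by positivity)
  set δ := η / (2 * (N + 1))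
  have hδ : 0 ≤ δ := by positivity
  have hF := primitive_mem_BV (hg.integrable_of_hasCompactSupport hgs)
  set F : ℝ → ℝ := fun t => ∫ y in 0..t, g y
  have hfF : (fun t => f t - F t) ∈ BV := hV.trans_lt ENNReal.ofReal_lt_top
  filter_upwards [eventually_gt_atTop 0,
    ENNReal.tendsto_nhds_zero.1 (tendsto_variation_samplingSeries_primitive hχ hm hg hgs)
      (ENNReal.ofReal (η / 2)) (by simpa using hη0)] with w hw hwF
  set S := samplingSeries (averagedKernel χ m) w
  have hdecomp : (fun t => S f t - f t) =
      fun t => (S (fun t => f t - F t) t + (S F t - F t)) + -(f t - F t) := by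
    ext t
    simp only [S, samplingSeries_sub hχ m hf.1 hF]
    ring
  rw [hdecomp]
  calc _ ≤ (variation (S fun t => f t - F t) + variation fun t => S F t - F t) +
          variation fun t => f t - F t := by
        refine (variation_add_le _ _).trans (add_le_add (variation_add_le _ _) ?_)
        rw [variation_neg]
    _ ≤ (ENNReal.ofReal δ * ENNReal.ofReal N + ENNReal.ofReal (η / 2)) + ENNReal.ofReal δ := by
        refine add_le_add (add_le_add ((variation_samplingSeries_le hχ hm hfF hw).trans ?_) hwF) hV
        rw [← ofReal_integral_norm_eq_lintegral_enorm hχ.integrable]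
        exact mul_le_mul_left hV _
    _ = ENNReal.ofReal η := by
        rw [← ENNReal.ofReal_mul hδ, ← ENNReal.ofReal_add (by positivity) (by positivity),
          ← ENNReal.ofReal_add (by positivity) hδ]
        congr 1
        simp only [δ]
        field_simp
        ring
    _ ≤ ε := hηε.le

/-! ### Convergence implies absolute continuity -/

/-- In the integral form of the increments the coefficients are at most `|w/m| 2C`, and the
translates of `|χ|` sum to at most `A`. -/
theorem exists_lipschitzWith_samplingSeries {χ : ℝ → ℝ} (hχ : IsKernel χ) (m : ℕ) {f : ℝ → ℝ}
    (hf : f ∈ BV) (w : ℝ) :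
    ∃ K, LipschitzWith K (samplingSeries (averagedKernel χ m) w f) := by
  obtain ⟨C, hC⟩ := exists_bound_of_mem_BV hf
  obtain ⟨A, hA⟩ := hχ.exists_moment_bound
  have hC0 : 0 ≤ C := (abs_nonneg _).trans (hC 0)
  have key : ∀ s t, s ≤ t → dist (samplingSeries (averagedKernel χ m) w f s)
      (samplingSeries (averagedKernel χ m) w f t) ≤ |w / m| * (2 * C) * A * (t - s) := by
    intro s t hst
    have hsum := (summable_integral_abs_comp hχ w (m / 2) hst).mul_left (|w / m| * (2 * C))
    rw [dist_comm, dist_eq_norm, ← (hasSum_samplingSeries_sub hχ m hf w hst).tsum_eq]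
    refine (tsum_of_norm_bounded hsum.hasSum fun k => ?_).trans ?_
    · rw [norm_mul, norm_mul]
      refine mul_le_mul (mul_le_mul_of_nonneg_left ?_ (norm_nonneg _))
        (intervalIntegral.abs_integral_le_integral_abs hst) (norm_nonneg _) (by positivity)
      rw [two_mul]
      exact (norm_sub_le _ _).trans (add_le_add (hC _) (hC _))
    · rw [tsum_mul_left, mul_assoc _ A]
      refine mul_le_mul_of_nonneg_left ?_ (by positivity)
      exact Real.tsum_le_of_sum_le
        (fun k => intervalIntegral.integral_nonneg hst fun _ _ => abs_nonneg _)
        (sum_integral_abs_comp_le hχ.continuous hA w _ hst)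
  refine ⟨(|w / m| * (2 * C) * A).toNNReal, LipschitzWith.of_dist_le_mul fun s t => ?_⟩
  have hle := Real.le_coe_toNNReal (|w / m| * (2 * C) * A)
  rcases le_total s t with h | h
  · rw [dist_comm s, Real.dist_eq t, abs_of_nonneg (sub_nonneg.2 h)]
    exact (key s t h).trans (mul_le_mul_of_nonneg_right hle (sub_nonneg.2 h))
  · rw [dist_comm, Real.dist_eq s, abs_of_nonneg (sub_nonneg.2 h)]
    exact (key t s h).trans (mul_le_mul_of_nonneg_right hle (sub_nonneg.2 h))

theorem sum_eVariationOn_uIcc_le {ι : Type*} (f : ℝ → ℝ) (I : ι → ℝ × ℝ) (s : Finset ι) :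
    (s : Set ι).PairwiseDisjoint (fun i => uIoc (I i).1 (I i).2) →
    ∑ i ∈ s, eVariationOn f (uIcc (I i).1 (I i).2) ≤
      eVariationOn f (⋃ i ∈ s, uIcc (I i).1 (I i).2) := by
  classical
  refine Finset.induction_on_max_value (fun i => min (I i).1 (I i).2) s (by simp) ?_
  -- Inserting intervals by increasing left endpoint puts the new one to the right of all the
  -- others, so variations add.
  intro j s hj hmax ih hdis
  rw [Finset.coe_insert, pairwiseDisjoint_insert] at hdis
  -- Degenerate intervals are treated apart: their `uIoc` is empty, so disjointness does not locate
  -- them, but their variation is zero.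
  have ih' := ih hdis.1
  rw [Finset.sum_insert hj, Finset.set_biUnion_insert]
  by_cases hdeg : (I j).1 = (I j).2
  · rw [hdeg, uIcc_self, eVariationOn.subsingleton f subsingleton_singleton, zero_add]
    exact ih'.trans (eVariationOn.mono f subset_union_right)
  · rw [add_comm, union_comm]
    refine (add_le_add ih' le_rfl).trans (eVariationOn.add_le_union f ?_)
    intro x hx y hy
    simp only [mem_iUnion] at hx
    obtain ⟨i, hi, hx⟩ := hx
    have hd := fun h => Set.disjoint_left.1 (hdis.2 i hi (fun h => hj (h ▸ hi)))
      (h : min (max (I i).1 (I i).2) (max (I j).1 (I j).2) ∈ _)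
    have hmin := hmax i hi
    simp only [uIoc, uIcc, mem_Ioc, mem_Icc] at hd hx hy
    refine hx.2.trans (le_trans ?_ hy.1)
    by_contra! hlt
    -- If the intervals overlapped, the smaller of the two right endpoints would lie in both
    -- half-open intervals.
    have hjlt : min (I j).1 (I j).2 < max (I j).1 (I j).2 := min_lt_max.2 hdeg
    exact hd ⟨lt_min hlt hjlt, min_le_right _ _⟩
      ⟨hmin.trans_lt (lt_min hlt hjlt), min_le_left _ _⟩

theorem sum_dist_le_variation {f : ℝ → ℝ} {a b : ℝ} {E : ℕ × (ℕ → ℝ × ℝ)}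
    (hE : E ∈ AbsolutelyContinuousOnInterval.disjWithin a b) {ε : ℝ} (hε : 0 ≤ ε)
    (hf : variation f ≤ ENNReal.ofReal ε) :
    ∑ i ∈ Finset.range E.1, dist (f (E.2 i).1) (f (E.2 i).2) ≤ ε := by
  rw [← ENNReal.ofReal_le_ofReal_iff hε, ENNReal.ofReal_sum_of_nonneg fun _ _ => dist_nonneg]
  refine le_trans ?_ hf
  refine (Finset.sum_le_sum fun i _ => ?_).trans ((sum_eVariationOn_uIcc_le f E.2 _ hE.2).trans
    (eVariationOn.mono f (subset_univ _)))
  rw [← edist_dist]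
  exact eVariationOn.edist_le f left_mem_uIcc right_mem_uIcc

theorem absolutelyContinuousOnInterval_of_variation_sub_le {f : ℝ → ℝ} {a b : ℝ}
    (H : ∀ ε > 0, ∃ G : ℝ → ℝ, AbsolutelyContinuousOnInterval G a b ∧
      variation (fun t => G t - f t) ≤ ENNReal.ofReal ε) :
    AbsolutelyContinuousOnInterval f a b := by
  rw [absolutelyContinuousOnInterval_iff]
  intro ε hε
  obtain ⟨G, hG, hV⟩ := H (ε / 2) (by positivity)
  obtain ⟨δ, hδ, hGδ⟩ := (absolutelyContinuousOnInterval_iff G a b).1 hG (ε / 2) (by positivity)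
  refine ⟨δ, hδ, fun E hE hlen => ?_⟩
  have h1 := hGδ E hE hlen
  have h2 := sum_dist_le_variation hE (by positivity) hV
  have h3 : ∑ i ∈ Finset.range E.1, dist (f (E.2 i).1) (f (E.2 i).2) ≤
      ∑ i ∈ Finset.range E.1, (dist (G (E.2 i).1) (G (E.2 i).2) +
        dist (G (E.2 i).1 - f (E.2 i).1) (G (E.2 i).2 - f (E.2 i).2)) :=
    Finset.sum_le_sum fun i _ => by
      simpa using dist_sub_sub_le (G (E.2 i).1) (G (E.2 i).1 - f (E.2 i).1) (G (E.2 i).2)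
        (G (E.2 i).2 - f (E.2 i).2)
  rw [Finset.sum_add_distrib] at h3
  linarith

theorem mem_AC_of_tendsto_variation {χ : ℝ → ℝ} (hχ : IsKernel χ) (m : ℕ) {f : ℝ → ℝ}
    (hf : f ∈ BV)
    (h : Tendsto (fun w => variation fun t => samplingSeries (averagedKernel χ m) w f t - f t)
      atTop (𝓝 0)) : f ∈ AC := by
  refine ⟨hf, fun a b => absolutelyContinuousOnInterval_of_variation_sub_le fun ε hε => ?_⟩
  -- A single `w` per `ε` suffices, since every `S_w f` is Lipschitz.
  obtain ⟨w, hw⟩ := (ENNReal.tendsto_nhds_zero.1 h _ (ENNReal.ofReal_pos.2 hε)).exists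
  obtain ⟨K, hK⟩ := exists_lipschitzWith_samplingSeries hχ m hf w
  exact ⟨_, (hK.lipschitzOnWith (s := uIcc a b)).absolutelyContinuousOnInterval, hw⟩

end SamplingBV

theorem theorem3p3 (χ : ℝ → ℝ) (hχ : SamplingBV.IsKernel χ) (m : ℕ) (hm : 1 ≤ m)
    (f : ℝ → ℝ) (hf : f ∈ SamplingBV.BV) :
    Tendsto
      (fun w : ℝ => SamplingBV.variation
        (fun t => SamplingBV.samplingSeries (SamplingBV.averagedKernel χ m) w f t - f t))
      atTop (𝓝 0) ↔ f ∈ SamplingBV.AC :=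
  ⟨SamplingBV.mem_AC_of_tendsto_variation hχ m hf, SamplingBV.tendsto_variation_of_mem_AC hχ hm⟩
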